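/- Let $q,\alpha,\beta,s,t$ be complex numbers with $\max\{|q|,|\alpha|,|\beta|,|s|,|t|\}<1$. Write $(a;q)_0=1$, $(a;q)_n=\prod_{k=0}^{n-1}(1-aq^k)$ for $n\ge 1$, $(a;q)_\infty=\prod_{k=0}^{\infty}(1-aq^k)$, and $(a_1,\dots,a_m;q)_\infty=\prod_{j=1}^m (a_j;q)_\infty$. Then \[ \int_{0}^{2\pi}\frac{(\alpha t e^{i\theta},\beta t e^{-i\theta},\alpha s e^{i\theta},\beta s e^{-i\theta}, e^{2i\theta}, e^{-2i\theta};q)_\infty} {(t e^{i\theta}, t e^{-i\theta}, s e^{i\theta}, s e^{-i\theta}, \alpha e^{2i\theta}, \beta e^{-2i\theta};q)_\infty}\,d\theta =\frac{2\pi(\alpha,\beta;q)_\infty}{(q,\alpha\beta;q)_\infty} \sum_{n=0}^{\infty}\left(\frac{1}{1-\alpha q^n}+\frac{1}{1-\beta q^n}\right)\frac{(\alpha\beta;q)_n}{(q;q)_n}(st)^n, \] where the integrand is integrable on $[0,2\pi]$ and the series on the right converges absolutely. -/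

import Mathlib

/-- The finite `q`-shifted factorial `(a;q)_n = ∏_{k=0}^{n-1} (1 - a q^k)`. -/
noncomputable def qPoch (a q : ℂ) (n : ℕ) : ℂ :=
  ∏ k ∈ Finset.range n, (1 - a * q ^ k)

/-- The infinite `q`-shifted factorial `(a;q)_∞ = ∏_{k=0}^∞ (1 - a q^k)`, for `|q| < 1`. -/
noncomputable def qPochInf (a q : ℂ) : ℂ :=
  ∏' k : ℕ, (1 - a * q ^ k)

/-- The product defining `(a;q)_∞` converges for `|q| < 1`. -/
theorem multipliable_qPochInf (a : ℂ) {q : ℂ} (hq : ‖q‖ < 1) :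
    Multipliable fun k : ℕ => 1 - a * q ^ k := by
  have h : Summable fun k : ℕ => ‖-(a * q ^ k)‖ := by
    simp only [norm_neg, norm_mul, norm_pow]
    exact (summable_geometric_of_lt_one (norm_nonneg q) hq).mul_left _
  simpa [sub_eq_add_neg] using multipliable_one_add_of_summable h

/-- The integrand of the `q`-beta integral, with `e = exp(iθ)` and `f = exp(-iθ)`. -/
noncomputable def qBetaIntegrand (q α β s t : ℂ) (θ : ℝ) : ℂ :=
  let e : ℂ := Complex.exp (Complex.I * θ)
  let f : ℂ := Complex.exp (-(Complex.I * θ))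
  (qPochInf (α * t * e) q * qPochInf (β * t * f) q * qPochInf (α * s * e) q *
      qPochInf (β * s * f) q * qPochInf (e ^ 2) q * qPochInf (f ^ 2) q) /
    (qPochInf (t * e) q * qPochInf (t * f) q * qPochInf (s * e) q *
      qPochInf (s * f) q * qPochInf (α * e ^ 2) q * qPochInf (β * f ^ 2) q)

/-- The `n`-th term of the series on the right-hand side. -/
noncomputable def qBetaTerm (q α β s t : ℂ) (n : ℕ) : ℂ :=
  (1 / (1 - α * q ^ n) + 1 / (1 - β * q ^ n)) * (qPoch (α * β) q n / qPoch q q n) * (s * t) ^ n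

/-!
Put `z = exp (i θ)` and `u = z ^ 2`. By the `q`-binomial theorem, the quotient
`(α t z, β t / z; q)_∞ / (t z, t / z; q)_∞` generates the two-parameter Rogers polynomials `r_n`, so
the integrand is the double series of `t ^ m * s ^ n * r_m * r_n * W`, where the weight
`W = (u, 1 / u; q)_∞ / (α u, β / u; q)_∞` is `1 - 1 / u` times Ramanujan's theta quotient `Ψ`. The
Laurent coefficients of `Ψ` satisfy a two-term recurrence (Ramanujan's `₁ψ₁` sum). Convolved with
the coefficients of `r_n` it gives a first-order recurrence in `n` for the integrals of
`r_n * z ^ (n - 2 j) * Ψ`, by which these vanish for `1 ≤ j ≤ n`. Hence the `r_n` are orthogonal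
with respect to `W`, and only `j = 0` and `j = n + 1` contribute to the integral of `r_n ^ 2 * W`;
they produce the two fractions in the series.
-/

open Filter Topology
open Finset.HasAntidiagonal (antidiagonal mem_antidiagonal)

section NormLtOne

theorem norm_mul_lt_one {R : Type*} [SeminormedRing R] {a b : R} (ha : ‖a‖ < 1) (hb : ‖b‖ < 1) :
    ‖a * b‖ < 1 :=
  (norm_mul_le a b).trans_lt (mul_lt_one_of_nonneg_of_lt_one_left (norm_nonneg a) ha hb.le)

theorem one_sub_ne_zero_of_norm_lt_one {R : Type*} [SeminormedRing R] [NormOneClass R] {a : R}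
    (ha : ‖a‖ < 1) : 1 - a ≠ 0 := by
  intro h
  rw [← sub_eq_zero.1 h, norm_one] at ha
  exact lt_irrefl 1 ha

theorem norm_mul_pow_le {R : Type*} [NormedDivisionRing R] {q : R} (hq : ‖q‖ ≤ 1) (a : R)
    (n : ℕ) : ‖a * q ^ n‖ ≤ ‖a‖ := by
  rw [norm_mul, norm_pow]
  exact mul_le_of_le_one_right (norm_nonneg a) (pow_le_one₀ (norm_nonneg q) hq)

end NormLtOne

section qShiftedFactorial

variable {q : ℂ}

theorem one_sub_mul_pow_ne_zero {a : ℂ} (hq : ‖q‖ < 1) (ha : ‖a‖ < 1) (n : ℕ) :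
    1 - a * q ^ n ≠ 0 :=
  one_sub_ne_zero_of_norm_lt_one ((norm_mul_pow_le hq.le a n).trans_lt ha)

theorem one_sub_pow_succ_ne_zero (hq : ‖q‖ < 1) (n : ℕ) : 1 - q ^ (n + 1) ≠ 0 := by
  rw [pow_succ']
  exact one_sub_mul_pow_ne_zero hq hq n

theorem qPoch_zero (a q : ℂ) : qPoch a q 0 = 1 := Finset.prod_range_zero _

theorem qPoch_succ (a q : ℂ) (n : ℕ) : qPoch a q (n + 1) = qPoch a q n * (1 - a * q ^ n) :=
  Finset.prod_range_succ _ n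

theorem one_sub_mul_qPoch (a q : ℂ) (n : ℕ) :
    (1 - a) * qPoch (a * q) q n = qPoch a q (n + 1) := by
  simp only [qPoch, Finset.prod_range_succ', pow_zero, mul_one, pow_succ', mul_assoc]
  ring

theorem qPoch_self_succ (q : ℂ) (n : ℕ) :
    qPoch q q (n + 1) = qPoch q q n * (1 - q ^ (n + 1)) := by
  rw [qPoch_succ, ← pow_succ']

theorem qPoch_ne_zero {a : ℂ} (hq : ‖q‖ < 1) (ha : ‖a‖ < 1) (n : ℕ) : qPoch a q n ≠ 0 :=
  Finset.prod_ne_zero_iff.2 fun k _ => one_sub_mul_pow_ne_zero hq ha k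

theorem tendsto_qPoch (hq : ‖q‖ < 1) (a : ℂ) :
    Tendsto (qPoch a q) atTop (𝓝 (qPochInf a q)) :=
  (multipliable_qPochInf a hq).tendsto_prod_tprod_nat

theorem qPochInf_eq_one_sub_mul (hq : ‖q‖ < 1) (a : ℂ) :
    qPochInf a q = (1 - a) * qPochInf (a * q) q := by
  refine tendsto_nhds_unique ((tendsto_qPoch hq a).comp (tendsto_add_atTop_nat 1)) ?_
  simpa only [Function.comp_def, one_sub_mul_qPoch] using
    (tendsto_qPoch hq (a * q)).const_mul (1 - a)

theorem qPochInf_ne_zero {a : ℂ} (hq : ‖q‖ < 1) (ha : ‖a‖ < 1) : qPochInf a q ≠ 0 := by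
  simp only [qPochInf, sub_eq_add_neg]
  refine tprod_one_add_ne_zero_of_summable (fun k => ?_) ?_
  · rw [← sub_eq_add_neg]
    exact one_sub_mul_pow_ne_zero hq ha k
  · simp only [norm_neg, norm_mul, norm_pow]
    exact (summable_geometric_of_lt_one (norm_nonneg q) hq).mul_left _

theorem exists_norm_qPoch_inv_le {a : ℂ} (hq : ‖q‖ < 1) (ha : ‖a‖ < 1) :
    ∃ C, ∀ n, ‖(qPoch a q n)⁻¹‖ ≤ C :=
  let ⟨C, hC⟩ := ((tendsto_qPoch hq a).inv₀ (qPochInf_ne_zero hq ha)).norm.bddAbove_range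
  ⟨C, fun n => hC ⟨n, rfl⟩⟩

end qShiftedFactorial

section qSubPow

variable {R : Type*} [CommRing R]

/-- The `q`-analogue `(a - b)(a - b q) ⋯ (a - b q ^ (n - 1))` of `(a - b) ^ n`. It equals
`a ^ n (b / a; q)_n` for `a ≠ 0`; this form also covers `a = 0`. -/
def qSubPow (q a b : R) (n : ℕ) : R :=
  ∏ i ∈ Finset.range n, (a - b * q ^ i)

theorem qSubPow_zero (q a b : R) : qSubPow q a b 0 = 1 := Finset.prod_range_zero _

theorem qSubPow_succ (q a b : R) (n : ℕ) :
    qSubPow q a b (n + 1) = qSubPow q a b n * (a - b * q ^ n) :=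
  Finset.prod_range_succ _ n

theorem qSubPow_add (q a b : R) (m n : ℕ) :
    qSubPow q a b (m + n) = qSubPow q a b m * qSubPow q a (b * q ^ m) n := by
  simp only [qSubPow, Finset.prod_range_add, pow_add, mul_assoc]

theorem qSubPow_mul_mul (q a b x : R) (n : ℕ) :
    qSubPow q (a * x) (b * x) n = qSubPow q a b n * x ^ n := by
  have hfactor (i : ℕ) : a * x - b * x * q ^ i = (a - b * q ^ i) * x := by ring
  simp only [qSubPow, hfactor, Finset.prod_mul_distrib, Finset.prod_const, Finset.card_range]

theorem norm_qSubPow_le {𝕜 : Type*} [NormedField 𝕜] {q b : 𝕜} {r : ℝ} (hb : ‖b‖ ≤ r) (a : 𝕜)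
    (n : ℕ) :
    ‖qSubPow q a b n‖ ≤ ∏ i ∈ Finset.range n, (‖a‖ + r * ‖q‖ ^ i) := by
  rw [qSubPow, norm_prod]
  refine Finset.prod_le_prod (fun _ _ => norm_nonneg _) fun i _ => (norm_sub_le _ _).trans ?_
  rw [norm_mul, norm_pow]
  gcongr

theorem summable_prod_range_add_mul_pow {𝕜 : Type*} [NormedField 𝕜] [CompleteSpace 𝕜]
    {x ρ : 𝕜} (hx : ‖x‖ < 1) (hρ : ‖ρ‖ < 1) (r : 𝕜) :
    Summable fun n : ℕ => ∏ i ∈ Finset.range n, (x + r * ρ ^ i) := by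
  obtain ⟨c, hxc, hc⟩ := exists_between hx
  have hlim : Tendsto (fun n : ℕ => ‖x + r * ρ ^ n‖) atTop (𝓝 ‖x‖) := by
    simpa using ((tendsto_pow_atTop_nhds_zero_of_norm_lt_one hρ).const_mul r).const_add x |>.norm
  refine summable_of_ratio_norm_eventually_le hc ?_
  filter_upwards [hlim.eventually_lt_const hxc] with n hn
  rw [Finset.prod_range_succ, norm_mul, mul_comm]
  gcongr

end qSubPow

section qBinomialTheorem

variable {q a : ℂ}

/-- The coefficient of `x ^ k` in the expansion of `(b x; q)_∞ / (a x; q)_∞`. -/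
noncomputable def qQuotCoeff (q a b : ℂ) (k : ℕ) : ℂ := qSubPow q a b k / qPoch q q k

theorem qQuotCoeff_zero (q a b : ℂ) : qQuotCoeff q a b 0 = 1 := by
  rw [qQuotCoeff, qSubPow_zero, qPoch_zero, div_one]

theorem qQuotCoeff_succ (hq : ‖q‖ < 1) (a b : ℂ) (k : ℕ) :
    (1 - q ^ (k + 1)) * qQuotCoeff q a b (k + 1) = (a - b * q ^ k) * qQuotCoeff q a b k := by
  have hk := one_sub_pow_succ_ne_zero hq k
  have hP := qPoch_ne_zero hq hq k
  rw [qQuotCoeff, qQuotCoeff, qPoch_self_succ, qSubPow_succ]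
  field_simp

theorem qQuotCoeff_mul_mul (q a b x : ℂ) (k : ℕ) :
    qQuotCoeff q (a * x) (b * x) k = qQuotCoeff q a b k * x ^ k := by
  rw [qQuotCoeff, qQuotCoeff, qSubPow_mul_mul, div_mul_eq_mul_div]

theorem summable_norm_qQuotCoeff (hq : ‖q‖ < 1) (ha : ‖a‖ < 1) (b : ℂ) :
    Summable fun k => ‖qQuotCoeff q a b k‖ := by
  obtain ⟨C, hC⟩ := exists_norm_qPoch_inv_le hq hq
  have hM := (summable_prod_range_add_mul_pow (x := ‖a‖) (ρ := ‖q‖)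
    (by rwa [norm_norm]) (by rwa [norm_norm]) ‖b‖).mul_right C
  refine .of_nonneg_of_le (fun _ => norm_nonneg _) (fun k => ?_) hM
  rw [qQuotCoeff, div_eq_mul_inv, norm_mul]
  exact mul_le_mul (norm_qSubPow_le le_rfl a k) (hC k) (norm_nonneg _) (by positivity)

theorem one_sub_mul_tsum_qQuotCoeff (hq : ‖q‖ < 1) (ha : ‖a‖ < 1) (b : ℂ) :
    (1 - a) * ∑' k, qQuotCoeff q a b k = (1 - b) * ∑' k, qQuotCoeff q (a * q) (b * q) k := by
  have hs := (summable_norm_qQuotCoeff hq ha b).of_norm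
  have hs' := (summable_norm_qQuotCoeff hq (norm_mul_lt_one ha hq) (b * q)).of_norm
  have htail : ∑' k, qQuotCoeff q a b (k + 1) - ∑' k, qQuotCoeff q (a * q) (b * q) (k + 1) =
      a * ∑' k, qQuotCoeff q a b k - b * ∑' k, qQuotCoeff q (a * q) (b * q) k := by
    rw [← ((summable_nat_add_iff 1).2 hs).tsum_sub ((summable_nat_add_iff 1).2 hs'),
      ← tsum_mul_left, ← tsum_mul_left, ← (hs.mul_left a).tsum_sub (hs'.mul_left b)]
    refine tsum_congr fun k => ?_
    rw [qQuotCoeff_mul_mul, qQuotCoeff_mul_mul]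
    linear_combination qQuotCoeff_succ hq a b k
  have h0 := hs.tsum_eq_zero_add
  have h0' := hs'.tsum_eq_zero_add
  rw [qQuotCoeff_zero] at h0 h0'
  linear_combination h0 - h0' + htail

theorem qPoch_mul_tsum_qQuotCoeff (hq : ‖q‖ < 1) (ha : ‖a‖ < 1) (b : ℂ) (n : ℕ) :
    qPoch a q n * ∑' k, qQuotCoeff q a b k =
      qPoch b q n * ∑' k, qQuotCoeff q (a * q ^ n) (b * q ^ n) k := by
  induction n with
  | zero => simp only [qPoch_zero, pow_zero, mul_one]
  | succ n ih =>
    have h := one_sub_mul_tsum_qQuotCoeff hq ((norm_mul_pow_le hq.le a n).trans_lt ha) (b * q ^ n)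
    rw [qPoch_succ, qPoch_succ, pow_succ, ← mul_assoc, ← mul_assoc]
    linear_combination (1 - a * q ^ n) * ih + qPoch b q n * h

theorem tendsto_tsum_qQuotCoeff_mul_pow (hq : ‖q‖ < 1) (ha : ‖a‖ < 1) (b : ℂ) :
    Tendsto (fun n : ℕ => ∑' k, qQuotCoeff q (a * q ^ n) (b * q ^ n) k) atTop (𝓝 1) := by
  rw [← tsum_ite_eq (0 : ℕ) (fun _ => (1 : ℂ))]
  refine tendsto_tsum_of_dominated_convergence (summable_norm_qQuotCoeff hq ha b) (fun k => ?_)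
    (Eventually.of_forall fun n k => ?_)
  · rcases Nat.eq_zero_or_pos k with rfl | hk
    · simp only [qQuotCoeff_zero, if_true, tendsto_const_nhds]
    · have hqk : ‖q ^ k‖ < 1 := by
        rw [norm_pow]
        exact pow_lt_one₀ (norm_nonneg q) hq hk.ne'
      simpa [qQuotCoeff_mul_mul, hk.ne', ← pow_mul, mul_comm k] using
        (tendsto_pow_atTop_nhds_zero_of_norm_lt_one hqk).const_mul (qQuotCoeff q a b k)
  · rw [qQuotCoeff_mul_mul, ← pow_mul]
    exact norm_mul_pow_le hq.le _ _

/-- The `q`-binomial theorem. -/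
theorem tsum_qQuotCoeff (hq : ‖q‖ < 1) (ha : ‖a‖ < 1) (b : ℂ) :
    ∑' k, qQuotCoeff q a b k = qPochInf b q / qPochInf a q := by
  have hleft := (tendsto_qPoch hq a).mul_const (∑' k, qQuotCoeff q a b k)
  have hright := (tendsto_qPoch hq b).mul (tendsto_tsum_qQuotCoeff_mul_pow hq ha b)
  simp only [qPoch_mul_tsum_qQuotCoeff hq ha b] at hleft
  rw [eq_div_iff (qPochInf_ne_zero hq ha), mul_comm, tendsto_nhds_unique hleft hright, mul_one]

end qBinomialTheorem

section QuotientCorrelation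

variable {q a b a' b' : ℂ}

/-- The correlation `∑ l, d (l + m) * d' l` of the coefficients `d` of `(b x; q)_∞ / (a x; q)_∞`
with the coefficients `d'` of `(b' x; q)_∞ / (a' x; q)_∞`. For `b * b' = q` its values are,
up to a constant, coefficients of Ramanujan's `₁ψ₁` series. -/
noncomputable def qQuotCorr (q a b a' b' : ℂ) (m : ℕ) : ℂ :=
  ∑' l, qQuotCoeff q a b (l + m) * qQuotCoeff q a' b' l

/-- The `l`-th term of `qQuotCorr q a b a' b' m` divided by `qSubPow q a b m`, in a form that is
also meaningful where `qSubPow q a b m = 0`. -/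
noncomputable def qQuotCorrTerm (q a b a' b' : ℂ) (m l : ℕ) : ℂ :=
  qSubPow q a (b * q ^ m) l / qPoch q q (m + l) * qQuotCoeff q a' b' l

theorem qQuotCorr_eq_qSubPow_mul_tsum (q a b a' b' : ℂ) (m : ℕ) :
    qQuotCorr q a b a' b' m = qSubPow q a b m * ∑' l, qQuotCorrTerm q a b a' b' m l := by
  rw [qQuotCorr, ← tsum_mul_left]
  refine tsum_congr fun l => ?_
  rw [qQuotCorrTerm, qQuotCoeff, add_comm l m, qSubPow_add]
  ring

theorem qQuotCorrTerm_zero (hq : ‖q‖ < 1) (m : ℕ) :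
    qQuotCorrTerm q a b a' b' m 0 = (1 - q ^ (m + 1)) * qQuotCorrTerm q a b a' b' (m + 1) 0 := by
  have hm := one_sub_pow_succ_ne_zero hq m
  have hP := qPoch_ne_zero hq hq m
  simp only [qQuotCorrTerm, qSubPow_zero, qQuotCoeff_zero, add_zero, qPoch_self_succ]
  field_simp

theorem one_sub_pow_mul_qQuotCorrTerm (hq : ‖q‖ < 1) (m n : ℕ) :
    (1 - q ^ (n + 1)) * qQuotCorrTerm q a b a' b' m (n + 1) =
      (a - b * q ^ m) * (a' - b' * q ^ n) * qQuotCorrTerm q a b a' b' (m + 1) n := by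
  have hfactor : qSubPow q a (b * q ^ m) (n + 1) =
      (a - b * q ^ m) * qSubPow q a (b * q ^ (m + 1)) n := by
    rw [add_comm, qSubPow_add, qSubPow_succ, qSubPow_zero, pow_one, pow_zero, pow_succ]
    ring_nf
  rw [qQuotCorrTerm, qQuotCorrTerm, hfactor, show m + (n + 1) = m + 1 + n by omega]
  linear_combination (a - b * q ^ m) * qSubPow q a (b * q ^ (m + 1)) n / qPoch q q (m + 1 + n) *
    qQuotCoeff_succ hq a' b' n

theorem one_sub_pow_mul_qQuotCorrTerm_succ (hq : ‖q‖ < 1) (m n : ℕ) :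
    (1 - q ^ (n + 1)) * (1 - q ^ (m + n + 1)) * qQuotCorrTerm q a b a' b' m (n + 1) =
      (a - b * q ^ (m + n)) * (a' - b' * q ^ n) * qQuotCorrTerm q a b a' b' m n := by
  have hmn := one_sub_pow_succ_ne_zero hq (m + n)
  have hratio : (1 - q ^ (m + n + 1)) / qPoch q q (m + (n + 1)) = 1 / qPoch q q (m + n) := by
    have hP := qPoch_ne_zero hq hq (m + n)
    rw [← add_assoc, qPoch_self_succ]
    field_simp
  rw [qQuotCorrTerm, qQuotCorrTerm, qSubPow_succ]
  linear_combination qSubPow q a (b * q ^ m) n * (a - b * q ^ m * q ^ n) *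
    ((1 - q ^ (n + 1)) * qQuotCoeff q a' b' (n + 1) * hratio +
      1 / qPoch q q (m + n) * qQuotCoeff_succ hq a' b' n)

theorem sum_range_qQuotCorrTerm_sub (hq : ‖q‖ < 1) (hbb' : b * b' = q) (m n : ℕ) :
    ∑ l ∈ Finset.range (n + 1), (qQuotCorrTerm q a b a' b' m l -
        (1 - a' * b * q ^ m) * qQuotCorrTerm q a b a' b' (m + 1) l) =
      b * q ^ m * (a' - b' * q ^ n) * qQuotCorrTerm q a b a' b' (m + 1) n := by
  induction n with
  | zero =>
    rw [Finset.sum_range_one, qQuotCorrTerm_zero hq]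
    linear_combination q ^ m * qQuotCorrTerm q a b a' b' (m + 1) 0 * hbb'
  | succ n ih =>
    rw [Finset.sum_range_succ, ih]
    refine mul_left_cancel₀ (one_sub_pow_succ_ne_zero hq n) ?_
    linear_combination
      one_sub_pow_mul_qQuotCorrTerm (a := a) (b := b) (a' := a') (b' := b') hq m n -
      one_sub_pow_mul_qQuotCorrTerm_succ (a := a) (b := b) (a' := a') (b' := b') hq (m + 1) n +
      (1 - q ^ (n + 1)) * q ^ (m + n + 1) * qQuotCorrTerm q a b a' b' (m + 1) (n + 1) * hbb'

theorem exists_summable_norm_qQuotCorrTerm_le (hq : ‖q‖ < 1) (ha : ‖a‖ < 1) (ha' : ‖a'‖ < 1)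
    (b b' : ℂ) : ∃ M : ℕ → ℝ, Summable M ∧ ∀ m l, ‖qQuotCorrTerm q a b a' b' m l‖ ≤ M l := by
  obtain ⟨C, hC⟩ := exists_norm_qPoch_inv_le hq hq
  obtain ⟨B, hB⟩ := (summable_prod_range_add_mul_pow (x := ‖a‖) (ρ := ‖q‖)
    (by rwa [norm_norm]) (by rwa [norm_norm]) ‖b‖).tendsto_atTop_zero.bddAbove_range
  have hnum (m l : ℕ) : ‖qSubPow q a (b * q ^ m) l‖ ≤ B :=
    (norm_qSubPow_le (norm_mul_pow_le hq.le b m) a l).trans (hB ⟨l, rfl⟩)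
  refine ⟨fun l => B * C * ‖qQuotCoeff q a' b' l‖,
    (summable_norm_qQuotCoeff hq ha' b').mul_left _, fun m l => ?_⟩
  rw [qQuotCorrTerm, div_eq_mul_inv, norm_mul, norm_mul]
  exact mul_le_mul_of_nonneg_right (mul_le_mul (hnum m l) (hC (m + l)) (norm_nonneg _)
    ((norm_nonneg _).trans (hnum m l))) (norm_nonneg _)

theorem tsum_qQuotCorrTerm_succ (hq : ‖q‖ < 1) (ha : ‖a‖ < 1) (ha' : ‖a'‖ < 1)
    (hbb' : b * b' = q) (m : ℕ) :
    ∑' l, qQuotCorrTerm q a b a' b' m l =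
      (1 - a' * b * q ^ m) * ∑' l, qQuotCorrTerm q a b a' b' (m + 1) l := by
  obtain ⟨M, hM, hle⟩ := exists_summable_norm_qQuotCorrTerm_le hq ha ha' b b'
  have hs (m : ℕ) : Summable (qQuotCorrTerm q a b a' b' m) := .of_norm_bounded hM (hle m)
  have hsum := (hs m).hasSum.sub ((hs (m + 1)).hasSum.mul_left (1 - a' * b * q ^ m))
  have hpartial := hsum.tendsto_sum_nat.comp (tendsto_add_atTop_nat 1)
  have hvanish : Tendsto (fun n => b * q ^ m * (a' - b' * q ^ n) *
      qQuotCorrTerm q a b a' b' (m + 1) n) atTop (𝓝 0) := by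
    simpa using (((tendsto_pow_atTop_nhds_zero_of_norm_lt_one hq).const_mul b').const_sub
      a' |>.const_mul (b * q ^ m)).mul (hs (m + 1)).tendsto_atTop_zero
  simp only [Function.comp_def, sum_range_qQuotCorrTerm_sub hq hbb'] at hpartial
  exact sub_eq_zero.1 (tendsto_nhds_unique hpartial hvanish)

theorem tsum_qQuotCorrTerm_zero_eq_qPoch_mul (hq : ‖q‖ < 1) (ha : ‖a‖ < 1) (ha' : ‖a'‖ < 1)
    (hbb' : b * b' = q) (m : ℕ) :
    ∑' l, qQuotCorrTerm q a b a' b' 0 l =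
      qPoch (a' * b) q m * ∑' l, qQuotCorrTerm q a b a' b' m l := by
  induction m with
  | zero => rw [qPoch_zero, one_mul]
  | succ m ih =>
    rw [ih, tsum_qQuotCorrTerm_succ hq ha ha' hbb', qPoch_succ, mul_assoc (qPoch _ _ _)]

theorem tendsto_tsum_qQuotCorrTerm (hq : ‖q‖ < 1) (ha : ‖a‖ < 1) (ha' : ‖a'‖ < 1) (b b' : ℂ) :
    Tendsto (fun m => ∑' l, qQuotCorrTerm q a b a' b' m l) atTop
      (𝓝 (qPochInf (a * b') q / (qPochInf q q * qPochInf (a * a') q))) := by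
  have hlim : qPochInf (a * b') q / (qPochInf q q * qPochInf (a * a') q) =
      ∑' l, a ^ l / qPochInf q q * qQuotCoeff q a' b' l := by
    simp only [div_mul_eq_mul_div, mul_comm (a ^ _), ← qQuotCoeff_mul_mul]
    rw [tsum_div_const, tsum_qQuotCoeff hq (norm_mul_lt_one ha' ha), mul_comm b', mul_comm a',
      div_div, mul_comm (qPochInf q q)]
  obtain ⟨M, hM, hle⟩ := exists_summable_norm_qQuotCorrTerm_le hq ha ha' b b'
  rw [hlim]
  refine tendsto_tsum_of_dominated_convergence hM (fun l => ?_) (Eventually.of_forall hle)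
  have hnum : Tendsto (fun m : ℕ => qSubPow q a (b * q ^ m) l) atTop (𝓝 (a ^ l)) := by
    have := tendsto_finsetProd (Finset.range l) fun i _ =>
      (((tendsto_pow_atTop_nhds_zero_of_norm_lt_one hq).const_mul b).mul_const (q ^ i)).const_sub a
    simpa [qSubPow] using this
  exact (hnum.div ((tendsto_qPoch hq q).comp (tendsto_add_atTop_nat l))
    (qPochInf_ne_zero hq hq)).mul_const _

theorem qQuotCorr_zero (hq : ‖q‖ < 1) (ha : ‖a‖ < 1) (ha' : ‖a'‖ < 1) (hbb' : b * b' = q) :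
    qQuotCorr q a b a' b' 0 = qPochInf (a' * b) q * qPochInf (a * b') q /
      (qPochInf q q * qPochInf (a * a') q) := by
  have hlim := (tendsto_qPoch hq (a' * b)).mul (tendsto_tsum_qQuotCorrTerm hq ha ha' b b')
  simp only [← tsum_qQuotCorrTerm_zero_eq_qPoch_mul hq ha ha' hbb'] at hlim
  rw [qQuotCorr_eq_qSubPow_mul_tsum, qSubPow_zero, one_mul,
    tendsto_nhds_unique tendsto_const_nhds hlim, mul_div_assoc]

theorem qQuotCorr_succ (hq : ‖q‖ < 1) (ha : ‖a‖ < 1) (ha' : ‖a'‖ < 1) (hbb' : b * b' = q)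
    (m : ℕ) :
    qQuotCorr q a b a' b' (m + 1) * (1 - a' * b * q ^ m) =
      qQuotCorr q a b a' b' m * (a - b * q ^ m) := by
  rw [qQuotCorr_eq_qSubPow_mul_tsum, qQuotCorr_eq_qSubPow_mul_tsum, qSubPow_succ,
    tsum_qQuotCorrTerm_succ hq ha ha' hbb' m]
  ring

end QuotientCorrelation

section RogersConvolution

variable {q α β : ℂ} {c : ℤ → ℂ}

/-- The two-term recurrence of the coefficients of the bilateral series `₁ψ₁`, namely
`c (k + 1) / c k = (α - q ^ k) / (1 - β q ^ k)`. Writing `k = r - s` clears the negative powers of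
`q`, so that `q = 0` is covered too. -/
def IsQPsiCoeff (q α β : ℂ) (c : ℤ → ℂ) : Prop :=
  ∀ r s : ℕ, c (r - s) * (q ^ r - α * q ^ s) = c (r - s + 1) * (β * q ^ r - q ^ s)

theorem IsQPsiCoeff.reflect (hc : IsQPsiCoeff q α β c) :
    IsQPsiCoeff q β α fun k => c (1 - k) := fun r s => by
  have h := hc s r
  rw [show (s - r + 1 : ℤ) = 1 - (r - s) by ring, show (s - r : ℤ) = 1 - (r - s + 1) by ring] at h
  linear_combination h

/-- The sum of `(α; q)_i (β; q)_l / ((q; q)_i (q; q)_l) * c (j - i)` over `i + l = n`. If `c k` is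
the integral of `z ^ (-2 k)` against some function of `z` on the unit circle, this is the integral
of `r_n * z ^ (n - 2 j)` against it, `r_n` being the `n`-th Rogers polynomial. -/
noncomputable def rogersConv (q α β : ℂ) (c : ℤ → ℂ) (n : ℕ) (j : ℤ) : ℂ :=
  ∑ p ∈ antidiagonal n, qQuotCoeff q 1 α p.1 * qQuotCoeff q 1 β p.2 * c (j - p.1)

theorem rogersConv_reflect (q α β : ℂ) (c : ℤ → ℂ) (n : ℕ) (j : ℤ) :
    rogersConv q β α (fun k => c (1 - k)) n j = rogersConv q α β c n (n + 1 - j) := by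
  rw [rogersConv, rogersConv, ← Finset.Nat.sum_antidiagonal_swap]
  refine Finset.sum_congr rfl fun p hp => ?_
  have hindex : (1 - (j - p.2) : ℤ) = n + 1 - j - p.1 := by
    rw [← mem_antidiagonal.1 hp]
    push_cast
    ring
  rw [Prod.fst_swap, Prod.snd_swap, hindex, mul_comm (qQuotCoeff q 1 β p.2)]

theorem sum_antidiagonal_one_sub_pow_fst_mul (hq : ‖q‖ < 1) (a b : ℂ) (n : ℕ) (f : ℕ × ℕ → ℂ) :
    ∑ p ∈ antidiagonal (n + 1), (1 - q ^ p.1) * qQuotCoeff q a b p.1 * f p =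
      ∑ p ∈ antidiagonal n, (a - b * q ^ p.1) * qQuotCoeff q a b p.1 * f (p.1 + 1, p.2) := by
  simp only [Finset.Nat.sum_antidiagonal_succ, pow_zero, sub_self, zero_mul, zero_add,
    qQuotCoeff_succ hq]

theorem sum_antidiagonal_one_sub_pow_snd_mul (hq : ‖q‖ < 1) (a b : ℂ) (n : ℕ) (f : ℕ × ℕ → ℂ) :
    ∑ p ∈ antidiagonal (n + 1), (1 - q ^ p.2) * qQuotCoeff q a b p.2 * f p =
      ∑ p ∈ antidiagonal n, (a - b * q ^ p.2) * qQuotCoeff q a b p.2 * f (p.1, p.2 + 1) := by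
  simp only [Finset.Nat.sum_antidiagonal_succ', pow_zero, sub_self, zero_mul, zero_add,
    qQuotCoeff_succ hq]

theorem IsQPsiCoeff.rogersConv_succ (hq : ‖q‖ < 1) (hc : IsQPsiCoeff q α β c) {n d : ℕ} {j : ℤ}
    (hj : j + d = n + 1) :
    (1 - q ^ (n + 1)) * (1 - α * q ^ d) * rogersConv q α β c (n + 1) j =
      (1 - α * β * q ^ n) * (1 - q ^ d) * rogersConv q α β c n j := by
  -- For `i + l = n + 1` the factor on the left is
  -- `(1 - q ^ i) * (q ^ l - α * q ^ d) + (1 - q ^ l) * (1 - α * q ^ (d + i))`; its parts lower `i`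
  -- and `l` by one, and the recurrence of `c` brings both to the same value of `c`.
  have hsplit : (1 - q ^ (n + 1)) * (1 - α * q ^ d) * rogersConv q α β c (n + 1) j =
      ∑ p ∈ antidiagonal (n + 1), (1 - q ^ p.1) * qQuotCoeff q 1 α p.1 *
          (qQuotCoeff q 1 β p.2 * ((q ^ p.2 - α * q ^ d) * c (j - p.1))) +
        ∑ p ∈ antidiagonal (n + 1), (1 - q ^ p.2) * qQuotCoeff q 1 β p.2 *
          (qQuotCoeff q 1 α p.1 * ((1 - α * q ^ (d + p.1)) * c (j - p.1))) := by
    rw [rogersConv, Finset.mul_sum, ← Finset.sum_add_distrib]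
    refine Finset.sum_congr rfl fun p hp => ?_
    rw [← mem_antidiagonal.1 hp]
    ring
  rw [hsplit, sum_antidiagonal_one_sub_pow_fst_mul hq, sum_antidiagonal_one_sub_pow_snd_mul hq,
    ← Finset.sum_add_distrib, rogersConv, Finset.mul_sum]
  refine Finset.sum_congr rfl fun p hp => ?_
  rw [mem_antidiagonal] at hp
  have hstep := hc p.2 d
  rw [show (p.2 - d : ℤ) = j - (p.1 + 1 : ℕ) by omega,
    show (j - (p.1 + 1 : ℕ) + 1 : ℤ) = j - p.1 by omega] at hstep
  rw [← hp]
  linear_combination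
    (1 - α * q ^ p.1) * qQuotCoeff q 1 α p.1 * qQuotCoeff q 1 β p.2 * hstep

theorem IsQPsiCoeff.rogersConv_eq_zero (hq : ‖q‖ < 1) (hα : ‖α‖ < 1) (hc : IsQPsiCoeff q α β c)
    {n j : ℕ} (hj : 1 ≤ j) (hjn : j ≤ n) : rogersConv q α β c n j = 0 := by
  induction n with
  | zero => omega
  | succ n ih =>
    obtain ⟨d, hd⟩ := Nat.exists_eq_add_of_le hjn
    have hfactor : (1 - q ^ d) * rogersConv q α β c n j = 0 := by
      rcases Nat.eq_zero_or_pos d with rfl | hd0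
      · rw [pow_zero, sub_self, zero_mul]
      · rw [ih (by omega), mul_zero]
    have hsucc := hc.rogersConv_succ hq (j := j) (d := d) (n := n) (by omega)
    rw [mul_assoc (1 - α * β * q ^ n), hfactor, mul_zero] at hsucc
    exact (mul_eq_zero.1 hsucc).resolve_left
      (mul_ne_zero (one_sub_pow_succ_ne_zero hq n) (one_sub_mul_pow_ne_zero hq hα d))

theorem IsQPsiCoeff.qPoch_mul_rogersConv_zero (hq : ‖q‖ < 1) (hc : IsQPsiCoeff q α β c) (n : ℕ) :
    qPoch (α * q) q n * rogersConv q α β c n 0 = qPoch (α * β) q n * c 0 := by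
  induction n with
  | zero => simp [rogersConv, qPoch_zero, qQuotCoeff_zero]
  | succ n ih =>
    refine mul_left_cancel₀ (one_sub_pow_succ_ne_zero hq n) ?_
    rw [qPoch_succ, qPoch_succ]
    linear_combination
      qPoch (α * q) q n * hc.rogersConv_succ hq (j := 0) (d := n + 1) (n := n) (by simp) +
        (1 - α * β * q ^ n) * (1 - q ^ (n + 1)) * ih

theorem IsQPsiCoeff.qQuotCoeff_mul_rogersConv_zero (hq : ‖q‖ < 1) (hα : ‖α‖ < 1)
    (hc : IsQPsiCoeff q α β c) (n : ℕ) :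
    qQuotCoeff q 1 α n * rogersConv q α β c n 0 =
      c 0 * (1 - α) * (1 / (1 - α * q ^ n) * (qPoch (α * β) q n / qPoch q q n)) := by
  have hn := one_sub_mul_pow_ne_zero hq hα n
  have hqn := qPoch_ne_zero hq hq n
  have hαn : qPoch α q n * (1 - α * q ^ n) = (1 - α) * qPoch (α * q) q n := by
    rw [one_sub_mul_qPoch, qPoch_succ]
  rw [show qQuotCoeff q 1 α n = qPoch α q n / qPoch q q n from rfl]
  field_simp
  linear_combination rogersConv q α β c n 0 * hαn + (1 - α) * hc.qPoch_mul_rogersConv_zero hq n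

theorem IsQPsiCoeff.sum_rogersConv_sub (hq : ‖q‖ < 1) (hα : ‖α‖ < 1) (hβ : ‖β‖ < 1)
    (hc : IsQPsiCoeff q α β c) (n : ℕ) :
    ∑ p ∈ antidiagonal n, qQuotCoeff q 1 α p.1 * qQuotCoeff q 1 β p.2 *
        (rogersConv q α β c n p.2 - rogersConv q α β c n (p.2 + 1)) =
      c 0 * (1 - α) * ((1 / (1 - α * q ^ n) + 1 / (1 - β * q ^ n)) *
        (qPoch (α * β) q n / qPoch q q n)) := by
  have hfst : ∑ p ∈ antidiagonal n,
      qQuotCoeff q 1 α p.1 * qQuotCoeff q 1 β p.2 * rogersConv q α β c n p.2 =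
        qQuotCoeff q 1 α n * rogersConv q α β c n 0 := by
    rw [Finset.sum_eq_single_of_mem (n, 0) (by simp), qQuotCoeff_zero, mul_one, Nat.cast_zero]
    intro p hp hne
    rw [mem_antidiagonal] at hp
    have hp2 : p.2 ≠ 0 := fun h => hne (Prod.ext (by omega) h)
    rw [hc.rogersConv_eq_zero hq hα (by omega) (by omega), mul_zero]
  have hsnd : ∑ p ∈ antidiagonal n,
      qQuotCoeff q 1 α p.1 * qQuotCoeff q 1 β p.2 * rogersConv q α β c n (p.2 + 1) =
        qQuotCoeff q 1 β n * rogersConv q β α (fun k => c (1 - k)) n 0 := by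
    rw [Finset.sum_eq_single_of_mem (0, n) (by simp), qQuotCoeff_zero, one_mul,
      rogersConv_reflect, sub_zero]
    intro p hp hne
    rw [mem_antidiagonal] at hp
    have hp1 : p.1 ≠ 0 := fun h => hne (Prod.ext h (by omega))
    have hzero := hc.rogersConv_eq_zero (j := p.2 + 1) (n := n) hq hα (by omega) (by omega)
    rw [Nat.cast_succ] at hzero
    rw [hzero, mul_zero]
  have hc1 : c 0 * (1 - α) = c 1 * (β - 1) := by simpa using hc 0 0
  simp only [mul_sub, Finset.sum_sub_distrib, hfst, hsnd, hc.qQuotCoeff_mul_rogersConv_zero hq hα,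
    hc.reflect.qQuotCoeff_mul_rogersConv_zero hq hβ, sub_zero, mul_comm β α]
  linear_combination 1 / (1 - β * q ^ n) * (qPoch (α * β) q n / qPoch q q n) * -hc1

end RogersConvolution

section Fourier

/-- The character `θ ↦ exp (i k θ)` of the circle. -/
noncomputable def circleChar (k : ℤ) (θ : ℝ) : ℂ := Complex.exp (k * (Complex.I * θ))

theorem continuous_circleChar (k : ℤ) : Continuous (circleChar k) := by
  unfold circleChar
  fun_prop

theorem norm_circleChar (k : ℤ) (θ : ℝ) : ‖circleChar k θ‖ = 1 := by
  rw [circleChar, show (k * (Complex.I * θ) : ℂ) = (k * θ : ℝ) * Complex.I by push_cast; ring,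
    Complex.norm_exp_ofReal_mul_I]

theorem norm_mul_circleChar (z : ℂ) (k : ℤ) (θ : ℝ) : ‖z * circleChar k θ‖ = ‖z‖ := by
  rw [norm_mul, norm_circleChar, mul_one]

theorem circleChar_zero (θ : ℝ) : circleChar 0 θ = 1 := by
  rw [circleChar, Int.cast_zero, zero_mul, Complex.exp_zero]

theorem circleChar_add (k l : ℤ) (θ : ℝ) :
    circleChar (k + l) θ = circleChar k θ * circleChar l θ := by
  rw [circleChar, circleChar, circleChar, ← Complex.exp_add, Int.cast_add, add_mul]

theorem circleChar_pow (k : ℤ) (n : ℕ) (θ : ℝ) :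
    circleChar k θ ^ n = circleChar (k * n) θ := by
  rw [circleChar, circleChar, ← Complex.exp_nat_mul]
  push_cast
  ring_nf

theorem integral_circleChar (k : ℤ) :
    ∫ θ in (0 : ℝ)..(2 * Real.pi), circleChar k θ = if k = 0 then 2 * (Real.pi : ℂ) else 0 := by
  split_ifs with hk
  · simp [hk, circleChar_zero]
  · have hkI : (k : ℂ) * Complex.I ≠ 0 := mul_ne_zero (Int.cast_ne_zero.2 hk) Complex.I_ne_zero
    simp only [circleChar, ← mul_assoc]
    rw [integral_exp_mul_complex hkI, mul_assoc (k : ℂ),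
      show Complex.I * ((2 * Real.pi : ℝ) : ℂ) = 2 * Real.pi * Complex.I by push_cast; ring,
      Complex.exp_int_mul_two_pi_mul_I]
    simp

theorem hasSum_integral_tsum_mul {ι : Type*} [Countable ι] {g : ι → ℝ → ℂ} {F : ℝ → ℂ} {M : ι → ℝ}
    (hF : Continuous F) (hg : ∀ n, Continuous (g n)) (hM : Summable M)
    (hle : ∀ n θ, ‖g n θ‖ ≤ M n) (x y : ℝ) :
    HasSum (fun n => ∫ θ in x..y, g n θ * F θ) (∫ θ in x..y, (∑' n, g n θ) * F θ) := by
  refine intervalIntegral.hasSum_integral_of_dominated_convergence (fun n θ => M n * ‖F θ‖)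
    (fun n => ((hg n).mul hF).aestronglyMeasurable) (fun n => .of_forall fun θ _ => ?_)
    (.of_forall fun θ _ => hM.mul_right _) ?_ (.of_forall fun θ _ => ?_)
  · rw [norm_mul]
    exact mul_le_mul_of_nonneg_right (hle n θ) (norm_nonneg _)
  · simp only [tsum_mul_right]
    exact (continuous_const.mul hF.norm).intervalIntegrable _ _
  · exact (Summable.of_norm_bounded hM fun n => hle n θ).hasSum.mul_right _

/-- The function on the circle with Fourier coefficient `a m` at the frequency `σ m`, `m ≥ 0`. -/
noncomputable def circleSeries (σ : ℤ) (a : ℕ → ℂ) (θ : ℝ) : ℂ :=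
  ∑' m : ℕ, a m * circleChar (σ * m) θ

variable {a b : ℕ → ℂ}

theorem continuous_circleSeries (σ : ℤ) (ha : Summable fun m => ‖a m‖) :
    Continuous (circleSeries σ a) :=
  continuous_tsum (fun _ => continuous_const.mul (continuous_circleChar _)) ha
    fun _ θ => (norm_mul_circleChar _ _ θ).le

theorem integral_circleSeries_mul (σ : ℤ) (ha : Summable fun m => ‖a m‖) {F : ℝ → ℂ}
    (hF : Continuous F) :
    ∫ θ in (0 : ℝ)..(2 * Real.pi), circleSeries σ a θ * F θ =
      ∑' m : ℕ, a m * ∫ θ in (0 : ℝ)..(2 * Real.pi), circleChar (σ * m) θ * F θ := by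
  have hsum := hasSum_integral_tsum_mul hF
    (fun m : ℕ => continuous_const.fun_mul (continuous_circleChar (σ * m))) ha
    (fun m θ => (norm_mul_circleChar (a m) _ θ).le) 0 (2 * Real.pi)
  simp only [mul_assoc, intervalIntegral.integral_const_mul] at hsum
  exact hsum.tsum_eq.symm

theorem integral_circleChar_mul_circleSeries_mul (σ k : ℤ)
    (ha : Summable fun m => ‖a m‖) (hb : Summable fun m => ‖b m‖) :
    ∫ θ in (0 : ℝ)..(2 * Real.pi), circleChar k θ * (circleSeries σ a θ * circleSeries (-σ) b θ) =
      ∑' m : ℕ, a m *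
        ∑' l : ℕ, b l * if -σ * l + (σ * m + k) = 0 then 2 * (Real.pi : ℂ) else 0 := by
  simp only [mul_left_comm (circleChar k _)]
  rw [integral_circleSeries_mul σ ha
    ((continuous_circleChar k).fun_mul (continuous_circleSeries (-σ) hb))]
  refine tsum_congr fun m => ?_
  simp only [← mul_assoc, ← circleChar_add]
  simp only [mul_comm _ (circleSeries _ _ _)]
  rw [integral_circleSeries_mul (-σ) hb (continuous_circleChar _)]
  simp only [← circleChar_add, integral_circleChar]

theorem integral_circleChar_mul_circleSeries_mul_natCast {σ : ℤ} (hσ : σ ≠ 0) (k : ℕ)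
    (ha : Summable fun m => ‖a m‖) (hb : Summable fun m => ‖b m‖) :
    ∫ θ in (0 : ℝ)..(2 * Real.pi),
        circleChar (σ * k) θ * (circleSeries σ a θ * circleSeries (-σ) b θ) =
      2 * (Real.pi : ℂ) * ∑' m : ℕ, b (m + k) * a m := by
  rw [integral_circleChar_mul_circleSeries_mul σ _ ha hb, ← tsum_mul_left]
  refine tsum_congr fun m => ?_
  have hiff (l : ℕ) : -σ * l + (σ * m + σ * k) = 0 ↔ l = m + k := by
    rw [show -σ * l + (σ * m + σ * k) = σ * ((m + k : ℕ) - l : ℤ) by push_cast; ring,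
      mul_eq_zero_iff_left hσ]
    omega
  simp only [hiff, mul_ite, mul_zero, tsum_ite_eq]
  ring

theorem integral_circleChar_mul_circleSeries_mul_eq_zero {σ k : ℤ} (hk : ¬ σ ∣ k)
    (ha : Summable fun m => ‖a m‖) (hb : Summable fun m => ‖b m‖) :
    ∫ θ in (0 : ℝ)..(2 * Real.pi),
      circleChar k θ * (circleSeries σ a θ * circleSeries (-σ) b θ) = 0 := by
  have hne (l m : ℕ) : -σ * l + (σ * m + k) ≠ 0 := fun h =>
    hk ⟨l - m, by linear_combination h⟩
  simp only [integral_circleChar_mul_circleSeries_mul σ k ha hb, if_neg (hne _ _), mul_zero,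
    tsum_zero]

theorem circleSeries_qQuotCoeff {q a : ℂ} (hq : ‖q‖ < 1) (ha : ‖a‖ < 1) (b : ℂ) (σ : ℤ) (θ : ℝ) :
    circleSeries σ (qQuotCoeff q a b) θ =
      qPochInf (b * circleChar σ θ) q / qPochInf (a * circleChar σ θ) q := by
  rw [← tsum_qQuotCoeff hq (by rwa [norm_mul_circleChar])]
  simp only [qQuotCoeff_mul_mul, circleChar_pow, circleSeries]

end Fourier

section Weight

variable {q α β : ℂ}

/-- Ramanujan's theta quotient `(u, q / u; q)_∞ / (α u, β / u; q)_∞` at `u = exp (2 i θ)`. -/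
noncomputable def qPsi (q α β : ℂ) (θ : ℝ) : ℂ :=
  qPochInf (circleChar 2 θ) q * qPochInf (q * circleChar (-2) θ) q /
    (qPochInf (α * circleChar 2 θ) q * qPochInf (β * circleChar (-2) θ) q)

theorem qPsi_eq_circleSeries_mul (hq : ‖q‖ < 1) (hα : ‖α‖ < 1) (hβ : ‖β‖ < 1) (θ : ℝ) :
    qPsi q α β θ =
      circleSeries 2 (qQuotCoeff q α 1) θ * circleSeries (-2) (qQuotCoeff q β q) θ := by
  rw [circleSeries_qQuotCoeff hq hα, circleSeries_qQuotCoeff hq hβ, div_mul_div_comm, one_mul, qPsi]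

theorem continuous_qPsi (hq : ‖q‖ < 1) (hα : ‖α‖ < 1) (hβ : ‖β‖ < 1) :
    Continuous (qPsi q α β) := by
  rw [funext (qPsi_eq_circleSeries_mul hq hα hβ)]
  exact (continuous_circleSeries _ (summable_norm_qQuotCoeff hq hα 1)).mul
    (continuous_circleSeries _ (summable_norm_qQuotCoeff hq hβ q))

/-- The Fourier coefficient of `qPsi q α β` at `u ^ j`, times `2 π`. -/
noncomputable def qPsiMoment (q α β : ℂ) (j : ℤ) : ℂ :=
  ∫ θ in (0 : ℝ)..(2 * Real.pi), circleChar (-2 * j) θ * qPsi q α β θ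

theorem qPsiMoment_natCast (hq : ‖q‖ < 1) (hα : ‖α‖ < 1) (hβ : ‖β‖ < 1) (m : ℕ) :
    qPsiMoment q α β m = 2 * Real.pi * qQuotCorr q α 1 β q m := by
  rw [qPsiMoment, qQuotCorr, ← integral_circleChar_mul_circleSeries_mul_natCast
    (by norm_num : (-2 : ℤ) ≠ 0) m (summable_norm_qQuotCoeff hq hβ q)
    (summable_norm_qQuotCoeff hq hα 1)]
  simp only [qPsi_eq_circleSeries_mul hq hα hβ, neg_neg, mul_comm (circleSeries 2 _ _)]

theorem qPsiMoment_neg_natCast (hq : ‖q‖ < 1) (hα : ‖α‖ < 1) (hβ : ‖β‖ < 1) (m : ℕ) :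
    qPsiMoment q α β (-m) = 2 * Real.pi * qQuotCorr q β q α 1 m := by
  rw [qPsiMoment, qQuotCorr, ← integral_circleChar_mul_circleSeries_mul_natCast
    (by norm_num : (2 : ℤ) ≠ 0) m (summable_norm_qQuotCoeff hq hα 1)
    (summable_norm_qQuotCoeff hq hβ q)]
  simp only [qPsi_eq_circleSeries_mul hq hα hβ, neg_mul_neg]

theorem isQPsiCoeff_qPsiMoment (hq : ‖q‖ < 1) (hα : ‖α‖ < 1) (hβ : ‖β‖ < 1) :
    IsQPsiCoeff q α β (qPsiMoment q α β) := by
  intro r s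
  rcases le_or_gt s r with hsr | hrs
  · obtain ⟨m, rfl⟩ := Nat.exists_eq_add_of_le hsr
    rw [show ((s + m : ℕ) - s : ℤ) = m by push_cast; ring, ← Nat.cast_succ,
      qPsiMoment_natCast hq hα hβ, qPsiMoment_natCast hq hα hβ]
    linear_combination 2 * Real.pi * q ^ s * qQuotCorr_succ hq hα hβ (one_mul q) m
  · obtain ⟨m, rfl⟩ := Nat.exists_eq_add_of_lt hrs
    rw [show (r - (r + m + 1 : ℕ) + 1 : ℤ) = -m by push_cast; ring,
      show (r - (r + m + 1 : ℕ) : ℤ) = -(m + 1 : ℕ) by push_cast; ring,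
      qPsiMoment_neg_natCast hq hα hβ, qPsiMoment_neg_natCast hq hα hβ]
    linear_combination 2 * Real.pi * q ^ r * qQuotCorr_succ hq hβ hα (mul_one q) m

theorem qPsiMoment_zero_mul_one_sub (hq : ‖q‖ < 1) (hα : ‖α‖ < 1) (hβ : ‖β‖ < 1) :
    qPsiMoment q α β 0 * (1 - α) =
      2 * (Real.pi : ℂ) * (qPochInf α q * qPochInf β q) / (qPochInf q q * qPochInf (α * β) q) := by
  rw [← Nat.cast_zero, qPsiMoment_natCast hq hα hβ, qQuotCorr_zero hq hα hβ (one_mul q),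
    qPochInf_eq_one_sub_mul hq α]
  ring_nf

/-- The weight `(u, 1 / u; q)_∞ / (α u, β / u; q)_∞` at `u = exp (2 i θ)`. -/
noncomputable def rogersWeight (q α β : ℂ) (θ : ℝ) : ℂ :=
  qPochInf (circleChar 2 θ) q * qPochInf (circleChar (-2) θ) q /
    (qPochInf (α * circleChar 2 θ) q * qPochInf (β * circleChar (-2) θ) q)

theorem rogersWeight_eq_mul_qPsi (hq : ‖q‖ < 1) (α β : ℂ) (θ : ℝ) :
    rogersWeight q α β θ = (1 - circleChar (-2) θ) * qPsi q α β θ := by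
  rw [rogersWeight, qPsi, qPochInf_eq_one_sub_mul hq (circleChar (-2) θ), mul_comm q]
  ring

theorem continuous_rogersWeight (hq : ‖q‖ < 1) (hα : ‖α‖ < 1) (hβ : ‖β‖ < 1) :
    Continuous (rogersWeight q α β) := by
  rw [funext (rogersWeight_eq_mul_qPsi hq α β)]
  exact (continuous_const.sub (continuous_circleChar _)).mul (continuous_qPsi hq hα hβ)

end Weight

section RogersPolynomials

variable {q α β : ℂ}

/-- The two-parameter Rogers polynomial `∑ (α; q)_i (β; q)_l / ((q; q)_i (q; q)_l) z ^ (i - l)`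
over `i + l = n`, at `z = exp (i θ)`. For `α = β` it is the continuous `q`-ultraspherical
polynomial `C_n (cos θ; β | q)`. -/
noncomputable def rogersPoly (q α β : ℂ) (n : ℕ) (θ : ℝ) : ℂ :=
  ∑ p ∈ antidiagonal n, qQuotCoeff q 1 α p.1 * qQuotCoeff q 1 β p.2 * circleChar (p.1 - p.2) θ

theorem continuous_rogersPoly (q α β : ℂ) (n : ℕ) : Continuous (rogersPoly q α β n) :=
  continuous_finsetSum _ fun _ _ => continuous_const.fun_mul (continuous_circleChar _)

theorem integral_rogersPoly_mul (q α β : ℂ) (n : ℕ) {F : ℝ → ℂ} (hF : Continuous F) :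
    ∫ θ in (0 : ℝ)..(2 * Real.pi), rogersPoly q α β n θ * F θ =
      ∑ p ∈ antidiagonal n, qQuotCoeff q 1 α p.1 * qQuotCoeff q 1 β p.2 *
        ∫ θ in (0 : ℝ)..(2 * Real.pi), circleChar (p.1 - p.2) θ * F θ := by
  simp only [rogersPoly, Finset.sum_mul, mul_assoc]
  rw [intervalIntegral.integral_finsetSum]
  · simp only [intervalIntegral.integral_const_mul]
  · exact fun p _ => (continuous_const.fun_mul (continuous_const.fun_mul
      ((continuous_circleChar _).fun_mul hF))).intervalIntegrable _ _

theorem integral_rogersPoly_mul_circleChar_mul_qPsi (hq : ‖q‖ < 1) (hα : ‖α‖ < 1)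
    (hβ : ‖β‖ < 1) (n : ℕ) (j : ℤ) :
    ∫ θ in (0 : ℝ)..(2 * Real.pi),
        rogersPoly q α β n θ * (circleChar (n - 2 * j) θ * qPsi q α β θ) =
      rogersConv q α β (qPsiMoment q α β) n j := by
  rw [integral_rogersPoly_mul _ _ _ _
    ((continuous_circleChar _).fun_mul (continuous_qPsi hq hα hβ)), rogersConv]
  refine Finset.sum_congr rfl fun p hp => ?_
  rw [mem_antidiagonal] at hp
  simp only [← mul_assoc, ← circleChar_add, qPsiMoment,
    show ((p.1 : ℤ) - p.2) + (n - 2 * j) = -2 * (j - p.1) by omega]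

theorem integral_rogersPoly_mul_circleChar_mul_qPsi_of_odd (hq : ‖q‖ < 1) (hα : ‖α‖ < 1)
    (hβ : ‖β‖ < 1) {n : ℕ} {k : ℤ} (hk : Odd (n + k)) :
    ∫ θ in (0 : ℝ)..(2 * Real.pi),
      rogersPoly q α β n θ * (circleChar k θ * qPsi q α β θ) = 0 := by
  rw [integral_rogersPoly_mul _ _ _ _
    ((continuous_circleChar _).fun_mul (continuous_qPsi hq hα hβ))]
  refine Finset.sum_eq_zero fun p hp => ?_
  have hodd : ¬ (2 : ℤ) ∣ p.1 - p.2 + k := by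
    obtain ⟨r, hr⟩ := hk
    rw [mem_antidiagonal] at hp
    omega
  simp only [← mul_assoc, ← circleChar_add, qPsi_eq_circleSeries_mul hq hα hβ]
  simp only [mul_assoc, integral_circleChar_mul_circleSeries_mul_eq_zero hodd
    (summable_norm_qQuotCoeff hq hα 1) (summable_norm_qQuotCoeff hq hβ q), mul_zero]

theorem integral_rogersPoly_mul_circleChar_mul_rogersWeight (hq : ‖q‖ < 1) (hα : ‖α‖ < 1)
    (hβ : ‖β‖ < 1) (n : ℕ) (k : ℤ) :
    ∫ θ in (0 : ℝ)..(2 * Real.pi),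
        rogersPoly q α β n θ * (circleChar k θ * rogersWeight q α β θ) =
      (∫ θ in (0 : ℝ)..(2 * Real.pi),
          rogersPoly q α β n θ * (circleChar k θ * qPsi q α β θ)) -
        ∫ θ in (0 : ℝ)..(2 * Real.pi),
          rogersPoly q α β n θ * (circleChar (k - 2) θ * qPsi q α β θ) := by
  have hint (k : ℤ) : IntervalIntegrable (fun θ => rogersPoly q α β n θ *
      (circleChar k θ * qPsi q α β θ)) MeasureTheory.volume 0 (2 * Real.pi) :=
    ((continuous_rogersPoly q α β n).fun_mul ((continuous_circleChar k).fun_mul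
      (continuous_qPsi hq hα hβ))).intervalIntegrable _ _
  rw [← intervalIntegral.integral_sub (hint k) (hint (k - 2))]
  refine intervalIntegral.integral_congr fun θ _ => ?_
  simp only [rogersWeight_eq_mul_qPsi hq, sub_eq_add_neg k 2, circleChar_add]
  ring

theorem integral_rogersPoly_mul_circleChar_mul_rogersWeight_eq_zero (hq : ‖q‖ < 1)
    (hα : ‖α‖ < 1) (hβ : ‖β‖ < 1) {n : ℕ} {k : ℤ} (hk : |k| < n) :
    ∫ θ in (0 : ℝ)..(2 * Real.pi),
      rogersPoly q α β n θ * (circleChar k θ * rogersWeight q α β θ) = 0 := by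
  rw [integral_rogersPoly_mul_circleChar_mul_rogersWeight hq hα hβ]
  obtain ⟨hnk, hkn⟩ := abs_lt.1 hk
  rcases Int.even_or_odd (n + k) with ⟨r, hr⟩ | hodd
  · obtain ⟨j, hj⟩ := Int.eq_ofNat_of_zero_le (show 0 ≤ (n - r : ℤ) by omega)
    have hc := isQPsiCoeff_qPsiMoment hq hα hβ
    rw [show k = n - 2 * (j : ℤ) by omega,
      show (n - 2 * j - 2 : ℤ) = n - 2 * (j + 1 : ℕ) by push_cast; ring,
      integral_rogersPoly_mul_circleChar_mul_qPsi hq hα hβ,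
      integral_rogersPoly_mul_circleChar_mul_qPsi hq hα hβ,
      hc.rogersConv_eq_zero hq hα (by omega) (by omega),
      hc.rogersConv_eq_zero hq hα (by omega) (by omega), sub_self]
  · have hodd' : Odd (n + (k - 2)) := by
      obtain ⟨r, hr⟩ := hodd
      exact ⟨r - 1, by omega⟩
    rw [integral_rogersPoly_mul_circleChar_mul_qPsi_of_odd hq hα hβ hodd,
      integral_rogersPoly_mul_circleChar_mul_qPsi_of_odd hq hα hβ hodd', sub_self]

theorem integral_rogersPoly_mul_rogersPoly (hq : ‖q‖ < 1) (hα : ‖α‖ < 1) (hβ : ‖β‖ < 1)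
    (m n : ℕ) :
    ∫ θ in (0 : ℝ)..(2 * Real.pi),
        rogersPoly q α β m θ * (rogersPoly q α β n θ * rogersWeight q α β θ) =
      ∑ p ∈ antidiagonal m, qQuotCoeff q 1 α p.1 * qQuotCoeff q 1 β p.2 *
        ∫ θ in (0 : ℝ)..(2 * Real.pi),
          rogersPoly q α β n θ * (circleChar (p.1 - p.2) θ * rogersWeight q α β θ) := by
  rw [integral_rogersPoly_mul _ _ _ _ ((continuous_rogersPoly q α β n).fun_mul
    (continuous_rogersWeight hq hα hβ))]
  simp only [mul_left_comm (circleChar _ _)]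

theorem integral_rogersPoly_mul_rogersPoly_of_ne (hq : ‖q‖ < 1) (hα : ‖α‖ < 1)
    (hβ : ‖β‖ < 1) {m n : ℕ} (hmn : m ≠ n) :
    ∫ θ in (0 : ℝ)..(2 * Real.pi),
      rogersPoly q α β m θ * (rogersPoly q α β n θ * rogersWeight q α β θ) = 0 := by
  wlog hlt : m < n generalizing m n
  · simp only [mul_left_comm (rogersPoly q α β m _)]
    exact this hmn.symm (by omega)
  rw [integral_rogersPoly_mul_rogersPoly hq hα hβ]
  refine Finset.sum_eq_zero fun p hp => ?_
  rw [mem_antidiagonal] at hp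
  rw [integral_rogersPoly_mul_circleChar_mul_rogersWeight_eq_zero hq hα hβ
    (abs_lt.2 ⟨by omega, by omega⟩), mul_zero]

theorem integral_rogersPoly_mul_self (hq : ‖q‖ < 1) (hα : ‖α‖ < 1) (hβ : ‖β‖ < 1) (n : ℕ) :
    ∫ θ in (0 : ℝ)..(2 * Real.pi),
        rogersPoly q α β n θ * (rogersPoly q α β n θ * rogersWeight q α β θ) =
      qPsiMoment q α β 0 * (1 - α) * ((1 / (1 - α * q ^ n) + 1 / (1 - β * q ^ n)) *
        (qPoch (α * β) q n / qPoch q q n)) := by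
  rw [integral_rogersPoly_mul_rogersPoly hq hα hβ,
    ← (isQPsiCoeff_qPsiMoment hq hα hβ).sum_rogersConv_sub hq hα hβ n]
  refine Finset.sum_congr rfl fun p hp => ?_
  rw [mem_antidiagonal] at hp
  rw [integral_rogersPoly_mul_circleChar_mul_rogersWeight hq hα hβ,
    show (p.1 - p.2 : ℤ) = n - 2 * p.2 by omega,
    show (n - 2 * p.2 - 2 : ℤ) = n - 2 * (p.2 + 1) by ring,
    integral_rogersPoly_mul_circleChar_mul_qPsi hq hα hβ,
    integral_rogersPoly_mul_circleChar_mul_qPsi hq hα hβ]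

end RogersPolynomials

section GeneratingFunction

variable {q α β t : ℂ}

/-- The generating function `(α t z, β t / z; q)_∞ / (t z, t / z; q)_∞` of the Rogers polynomials
in `z = exp (i θ)`. -/
noncomputable def rogersGenFun (q α β t : ℂ) (θ : ℝ) : ℂ :=
  qPochInf (α * t * circleChar 1 θ) q * qPochInf (β * t * circleChar (-1) θ) q /
    (qPochInf (t * circleChar 1 θ) q * qPochInf (t * circleChar (-1) θ) q)

theorem rogersGenFun_eq_circleSeries_mul (hq : ‖q‖ < 1) (ht : ‖t‖ < 1) (α β : ℂ) (θ : ℝ) :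
    rogersGenFun q α β t θ =
      circleSeries 1 (qQuotCoeff q t (α * t)) θ * circleSeries (-1) (qQuotCoeff q t (β * t)) θ := by
  rw [circleSeries_qQuotCoeff hq ht, circleSeries_qQuotCoeff hq ht, div_mul_div_comm, rogersGenFun]

theorem continuous_rogersGenFun (hq : ‖q‖ < 1) (ht : ‖t‖ < 1) (α β : ℂ) :
    Continuous (rogersGenFun q α β t) := by
  rw [funext (rogersGenFun_eq_circleSeries_mul hq ht α β)]
  exact (continuous_circleSeries _ (summable_norm_qQuotCoeff hq ht _)).mul
    (continuous_circleSeries _ (summable_norm_qQuotCoeff hq ht _))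

theorem pow_mul_rogersPoly (q α β t : ℂ) (n : ℕ) (θ : ℝ) :
    t ^ n * rogersPoly q α β n θ = ∑ p ∈ antidiagonal n,
      qQuotCoeff q t (α * t) p.1 * circleChar (1 * p.1) θ *
        (qQuotCoeff q t (β * t) p.2 * circleChar (-1 * p.2) θ) := by
  have hscale (c : ℂ) (k : ℕ) : qQuotCoeff q t (c * t) k = qQuotCoeff q 1 c k * t ^ k := by
    rw [← qQuotCoeff_mul_mul, one_mul]
  rw [rogersPoly, Finset.mul_sum]
  refine Finset.sum_congr rfl fun p hp => ?_
  rw [hscale, hscale, ← mem_antidiagonal.1 hp, pow_add,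
    show (p.1 - p.2 : ℤ) = 1 * p.1 + -1 * p.2 by ring, circleChar_add]
  ring

theorem tsum_pow_mul_rogersPoly (hq : ‖q‖ < 1) (ht : ‖t‖ < 1) (α β : ℂ) (θ : ℝ) :
    ∑' n, t ^ n * rogersPoly q α β n θ = rogersGenFun q α β t θ := by
  have hs (σ : ℤ) (c : ℂ) : Summable fun k : ℕ => ‖qQuotCoeff q t c k * circleChar (σ * k) θ‖ := by
    simpa only [norm_mul_circleChar] using summable_norm_qQuotCoeff hq ht c
  rw [rogersGenFun_eq_circleSeries_mul hq ht, circleSeries, circleSeries,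
    tsum_mul_tsum_eq_tsum_sum_antidiagonal_of_summable_norm (hs _ _) (hs _ _)]
  simp only [pow_mul_rogersPoly]

theorem exists_summable_norm_pow_mul_rogersPoly_le (hq : ‖q‖ < 1) (ht : ‖t‖ < 1) (α β : ℂ) :
    ∃ M : ℕ → ℝ, Summable M ∧ ∀ n θ, ‖t ^ n * rogersPoly q α β n θ‖ ≤ M n := by
  have hprod : Summable fun x : ℕ × ℕ =>
      ‖qQuotCoeff q t (α * t) x.1‖ * ‖qQuotCoeff q t (β * t) x.2‖ :=
    (summable_norm_qQuotCoeff hq ht _).mul_of_nonneg (summable_norm_qQuotCoeff hq ht _)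
      (fun _ => norm_nonneg _) fun _ => norm_nonneg _
  refine ⟨fun n => ∑ p ∈ antidiagonal n,
      ‖qQuotCoeff q t (α * t) p.1‖ * ‖qQuotCoeff q t (β * t) p.2‖,
    summable_sum_mul_antidiagonal_of_summable_mul
      (f := fun k => ‖qQuotCoeff q t (α * t) k‖) (g := fun k => ‖qQuotCoeff q t (β * t) k‖) hprod,
    fun n θ => ?_⟩
  rw [pow_mul_rogersPoly]
  refine norm_sum_le_of_le _ fun p _ => ?_
  rw [norm_mul, norm_mul_circleChar, norm_mul_circleChar]

theorem hasSum_integral_rogersPoly_mul (hq : ‖q‖ < 1) (ht : ‖t‖ < 1) (α β : ℂ) {F : ℝ → ℂ}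
    (hF : Continuous F) :
    HasSum (fun n => t ^ n * ∫ θ in (0 : ℝ)..(2 * Real.pi), rogersPoly q α β n θ * F θ)
      (∫ θ in (0 : ℝ)..(2 * Real.pi), rogersGenFun q α β t θ * F θ) := by
  obtain ⟨M, hM, hle⟩ := exists_summable_norm_pow_mul_rogersPoly_le hq ht α β
  have hsum := hasSum_integral_tsum_mul hF
    (fun n => continuous_const.fun_mul (continuous_rogersPoly q α β n)) hM hle 0 (2 * Real.pi)
  simpa only [mul_assoc, intervalIntegral.integral_const_mul, ← tsum_pow_mul_rogersPoly hq ht]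
    using hsum

theorem integral_rogersPoly_mul_rogersGenFun {s : ℂ} (hq : ‖q‖ < 1) (hα : ‖α‖ < 1)
    (hβ : ‖β‖ < 1) (hs : ‖s‖ < 1) (n : ℕ) :
    ∫ θ in (0 : ℝ)..(2 * Real.pi),
        rogersPoly q α β n θ * (rogersGenFun q α β s θ * rogersWeight q α β θ) =
      s ^ n * ∫ θ in (0 : ℝ)..(2 * Real.pi),
        rogersPoly q α β n θ * (rogersPoly q α β n θ * rogersWeight q α β θ) := by
  simp only [mul_left_comm (rogersPoly q α β n _) (rogersGenFun _ _ _ _ _)]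
  rw [← (hasSum_integral_rogersPoly_mul hq hs α β ((continuous_rogersPoly q α β n).fun_mul
    (continuous_rogersWeight hq hα hβ))).tsum_eq]
  refine tsum_eq_single n fun m hm => ?_
  rw [integral_rogersPoly_mul_rogersPoly_of_ne hq hα hβ hm, mul_zero]

theorem qBetaIntegrand_eq_rogersGenFun_mul (q α β s t : ℂ) (θ : ℝ) :
    qBetaIntegrand q α β s t θ =
      rogersGenFun q α β t θ * (rogersGenFun q α β s θ * rogersWeight q α β θ) := by
  have hz : Complex.exp (Complex.I * θ) = circleChar 1 θ := by simp [circleChar]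
  have hz' : Complex.exp (-(Complex.I * θ)) = circleChar (-1) θ := by simp [circleChar]
  have hu : circleChar 1 θ ^ 2 = circleChar 2 θ := circleChar_pow 1 2 θ
  have hu' : circleChar (-1) θ ^ 2 = circleChar (-2) θ := circleChar_pow (-1) 2 θ
  simp only [qBetaIntegrand, hz, hz', hu, hu', rogersGenFun, rogersWeight]
  ring

theorem continuous_qBetaIntegrand {s : ℂ} (hq : ‖q‖ < 1) (hα : ‖α‖ < 1) (hβ : ‖β‖ < 1)
    (hs : ‖s‖ < 1) (ht : ‖t‖ < 1) : Continuous (qBetaIntegrand q α β s t) := by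
  rw [funext (qBetaIntegrand_eq_rogersGenFun_mul q α β s t)]
  exact (continuous_rogersGenFun hq ht α β).mul
    ((continuous_rogersGenFun hq hs α β).mul (continuous_rogersWeight hq hα hβ))

theorem hasSum_qBetaTerm {s : ℂ} (hq : ‖q‖ < 1) (hα : ‖α‖ < 1) (hβ : ‖β‖ < 1)
    (hs : ‖s‖ < 1) (ht : ‖t‖ < 1) :
    HasSum (fun n => 2 * (Real.pi : ℂ) * (qPochInf α q * qPochInf β q) /
        (qPochInf q q * qPochInf (α * β) q) * qBetaTerm q α β s t n)
      (∫ θ in (0 : ℝ)..(2 * Real.pi), qBetaIntegrand q α β s t θ) := by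
  have hsum := hasSum_integral_rogersPoly_mul hq ht α β
    ((continuous_rogersGenFun hq hs α β).fun_mul (continuous_rogersWeight hq hα hβ))
  simp only [integral_rogersPoly_mul_rogersGenFun hq hα hβ hs,
    integral_rogersPoly_mul_self hq hα hβ, qPsiMoment_zero_mul_one_sub hq hα hβ,
    ← qBetaIntegrand_eq_rogersGenFun_mul] at hsum
  refine hsum.congr_fun fun n => ?_
  rw [qBetaTerm, mul_pow]
  ring

end GeneratingFunction

theorem theorem1p4 (q α β s t : ℂ) (hq : ‖q‖ < 1) (hα : ‖α‖ < 1) (hβ : ‖β‖ < 1)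
    (hs : ‖s‖ < 1) (ht : ‖t‖ < 1) :
    IntervalIntegrable (qBetaIntegrand q α β s t) MeasureTheory.volume 0 (2 * Real.pi) ∧
    Summable (qBetaTerm q α β s t) ∧
    ∫ θ in (0 : ℝ)..(2 * Real.pi), qBetaIntegrand q α β s t θ =
      2 * (Real.pi : ℂ) * (qPochInf α q * qPochInf β q) / (qPochInf q q * qPochInf (α * β) q) *
        ∑' n : ℕ, qBetaTerm q α β s t n := by
  have hsum := hasSum_qBetaTerm hq hα hβ hs ht
  have hconst : 2 * (Real.pi : ℂ) * (qPochInf α q * qPochInf β q) /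
      (qPochInf q q * qPochInf (α * β) q) ≠ 0 := by
    have hpoch {a : ℂ} (ha : ‖a‖ < 1) : qPochInf a q ≠ 0 := qPochInf_ne_zero hq ha
    simp [Real.pi_ne_zero, hpoch hq, hpoch hα, hpoch hβ, hpoch (norm_mul_lt_one hα hβ)]
  exact ⟨(continuous_qBetaIntegrand hq hα hβ hs ht).intervalIntegrable _ _,
    (summable_mul_left_iff hconst).1 hsum.summable, by rw [← hsum.tsum_eq, tsum_mul_left]⟩
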